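/- Fix a finite set $\Sigma$ of labels. A ($\Sigma$-labeled, $r$-relational) digraph $G=(V,(E_k)_{1\le k\le r},\lambda)$ consists of a finite nonempty set $V$ of nodes, sets $E_k\subseteq V\times V$ of directed edges, and a labeling $\lambda\colon V\to\Sigma$; a pointed digraph is a digraph with a distinguished node. A ditree with root $w$ is a digraph with pairwise disjoint $E_k$ in which from every node there is exactly one directed walk to $w$; it is ordered if every node has at most one incoming $k$-neighbor for each $k$, and every node with an incoming $(k+1)$-neighbor has an incoming $k$-neighbor. A pointed dipath is an ordered $1$-relational ditree pointed at its root. A distributed automaton $A=(Q,\iota,\delta,F)$ (over $1$-relational digraphs) has a finite nonempty set $Q$ of states, an initialization $\iota\colon\Sigma\to Q$, a transition function $\delta\colon Q\times 2^Q\to Q$ and accepting states $F\subseteq Q$. Its run on $G$ is given by $\rho_0(v)=\iota(\lambda(v))$ and $\rho_{t+1}(v)=\delta(\rho_t(v),\{\rho_t(u): uv\in E_1\})$; it accepts $(G,v)$ if $\rho_t(v)\in F$ for some $t\in\mathbb N$, and its language is the set of pointed digraphs it accepts. $A$ is monovisioned if there is a state $q_{\mathrm{rej}}\in Q\setminus F$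 such that $\delta(q,S)=q_{\mathrm{rej}}$ whenever $|S|>1$ or $q_{\mathrm{rej}}\in S$ or $q=q_{\mathrm{rej}}$. In the general form, an automaton over $r$-relational digraphs is $(Q,q_0,(\delta_a)_{a\in\Sigma},F)$ with $\delta_a\colon Q\times(2^Q)^r\to Q$, $\rho_0(v)=q_0$, and $\rho_{t+1}(v)=\delta_{\lambda(v)}\bigl(\rho_t(v),(\{\rho_t(u):uv\in E_k\})_{1\le k\le r}\bigr)$, and acceptance and language are defined as before. Then: 1. The language of a monovisioned distributed automaton is nonempty if and only if it contains a pointed dipath. 2. For every distributed automaton $A$ there is a monovisioned distributed automaton $A'$ that accepts exactly the same pointed dipaths as $A$; moreover, $A'$ can be computed from $A$. 3. The emptiness problem (given an automaton, presented by the finite tables of its components, decide whether its language is nonempty) is undecidable for monovisioned distributed automata over every fixed nonempty finite alphabet: no algorithm answers correctly on all monovisioned automata. 4. Consequently, over every fixed nonempty finite alphabet, the emptiness problem is undecidable for distributed automata $(Q,\iota,\delta,F)$, and for distributed automata $(Q,q_0,(\delta_a)_{a\in\Sigma},F)$ in the general form over $r$-relational digraphs, for every $r\ge 1$. -/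

import Mathlib

universe u v

namespace DA

/-- A finite `α`-labeled, `r`-relational directed graph: a finite nonempty set of nodes,
`r` edge relations and a labeling. `E k x y` means that there is a `k`-edge from `x` to `y`,
that is, `x` is an incoming `k`-neighbor of `y`. -/
structure LDigraph (α : Type u) (r : ℕ) where
  V : Type
  finite : Finite V
  nonempty : Nonempty V
  E : Fin r → V → V → Prop
  label : V → α

/-- A directed graph with a distinguished node. -/
structure PointedDigraph (α : Type u) (r : ℕ) where
  graph : LDigraph α r
  node : graph.V

namespace LDigraph

variable {α : Type u} {r : ℕ}

/-- `l` lists the nodes of a directed walk from `x` to `y` (along edges of any kind).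
The one-element list is the walk of length zero. -/
def IsWalk (G : LDigraph α r) (x y : G.V) (l : List G.V) : Prop :=
  l.head? = some x ∧ l.getLast? = some y ∧ l.IsChain (fun a b => ∃ k, G.E k a b)

/-- `G` is a directed rooted tree with root `ρ`: the edge relations are pairwise disjoint and
from every node there is exactly one way to reach `ρ`. -/
def IsDitree (G : LDigraph α r) (ρ : G.V) : Prop :=
  (∀ i j, i ≠ j → ∀ x y, ¬ (G.E i x y ∧ G.E j x y)) ∧
    ∀ x, ∃! l : List G.V, G.IsWalk x ρ l

/-- Every node has at most one incoming `k`-neighbor, and every node that has an incoming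
`(k+1)`-neighbor also has an incoming `k`-neighbor. -/
def IsOrdered (G : LDigraph α r) : Prop :=
  (∀ k x x' y, G.E k x y → G.E k x' y → x = x') ∧
    ∀ k l : Fin r, (l : ℕ) = k + 1 → ∀ y, (∃ x, G.E l x y) → ∃ x, G.E k x y

end LDigraph

/-- A pointed dipath: an ordered 1-relational directed rooted tree, pointed at its root. -/
def PointedDigraph.IsDipath {α : Type u} (P : PointedDigraph α 1) : Prop :=
  P.graph.IsDitree P.node ∧ P.graph.IsOrdered

/-- A distributed automaton over `α`-labeled `r`-relational digraphs with state set `Q`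
(which is always taken finite and nonempty), in the general form. -/
structure GenAut (α : Type u) (r : ℕ) (Q : Type v) where
  init : Q
  step : α → Q → (Fin r → Set Q) → Q
  accept : Set Q

/-- The run of a distributed automaton on a digraph. -/
def GenAut.run {α : Type u} {r : ℕ} {Q : Type v} (A : GenAut α r Q) (G : LDigraph α r) :
    ℕ → G.V → Q
  | 0, _ => A.init
  | t + 1, y => A.step (G.label y) (A.run G t y) (fun k => {q | ∃ x, G.E k x y ∧ A.run G t x = q})

/-- The set of pointed digraphs accepted by a distributed automaton. -/
def GenAut.language {α : Type u} {r : ℕ} {Q : Type v} (A : GenAut α r Q) :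
    Set (PointedDigraph α r) :=
  {P | ∃ t, A.run P.graph t P.node ∈ A.accept}

/-- A distributed automaton over `α`-labeled 1-relational digraphs with state set `Q`
(which is always taken finite and nonempty), in the simplified form: an initialization function
that reads the node label, a single transition function, and a set of accepting states. -/
structure DistAut (α : Type u) (Q : Type v) where
  init : α → Q
  step : Q → Set Q → Q
  accept : Set Q

namespace DistAut

variable {α : Type u} {Q : Type v}

/-- The run of a distributed automaton in simplified form on a 1-relational digraph. -/
def run (A : DistAut α Q) (G : LDigraph α 1) : ℕ → G.V → Q
  | 0, y => A.init (G.label y)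
  | t + 1, y => A.step (A.run G t y) {q | ∃ x, G.E 0 x y ∧ A.run G t x = q}

/-- The set of pointed digraphs accepted by a distributed automaton in simplified form. -/
def language (A : DistAut α Q) : Set (PointedDigraph α 1) :=
  {P | ∃ t, A.run P.graph t P.node ∈ A.accept}

/-- There is a rejecting sink state that is entered as soon as more than one state, or the sink
state itself, is seen among the incoming neighbors. -/
def Monovisioned (A : DistAut α Q) : Prop :=
  ∃ rej : Q, rej ∉ A.accept ∧
    ∀ (q : Q) (S : Set Q), (1 < S.encard ∨ rej ∈ S ∨ q = rej) → A.step q S = rej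

end DistAut

/-! ### Finite descriptions of automata

As inputs of algorithms, automata are given by their number of states and the complete
value tables of their components. -/

open Classical in
/-- The number with binary digits given by the indicator function of `S`. -/
noncomputable def setIndex {n : ℕ} (S : Set (Fin n)) : Fin (2 ^ n) :=
  finFunctionFinEquiv (fun q => if q ∈ S then (1 : Fin 2) else 0)

/-- A description of an automaton in simplified form: a number `n` (for the state set
`{0, …, n}`), the table of the initialization function, the table of the transition function and
a list of the accepting states. -/
abbrev DistCode : Type := ℕ × List ℕ × List ℕ × List ℕ

/-- The position of the value for `(q, S)` in the table of the transition function,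
namely `q * 2 ^ n + ∑ s ∈ S, 2 ^ s`. -/
noncomputable def distIndex {n : ℕ} (q : Fin n) (S : Set (Fin n)) : Fin (n * 2 ^ n) :=
  finProdFinEquiv (q, setIndex S)

/-- The automaton over the alphabet `Fin k` described by a code. Missing table entries are read
as `0` and entries are read modulo the number of states, so that every code describes an
automaton. -/
noncomputable def DistCode.toAut (k : ℕ) (c : DistCode) : DistAut (Fin k) (Fin (c.1 + 1)) where
  init a := Fin.ofNat (c.1 + 1) (c.2.1.getD a 0)
  step q S := Fin.ofNat (c.1 + 1) (c.2.2.1.getD (distIndex q S) 0)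
  accept := {q | (q : ℕ) ∈ c.2.2.2}

/-- A description of an automaton in general form: a number `n` (for the state set `{0, …, n}`),
the initial state, the table of the transition functions and a list of the accepting states. -/
abbrev GenCode : Type := ℕ × ℕ × List ℕ × List ℕ

/-- The position of the value for `(a, q, S)` in the table of the transition functions, namely
`(a * n + q) * (2 ^ n) ^ r + ∑ j, setIndex (S j) * (2 ^ n) ^ j`. -/
noncomputable def genIndex {k r n : ℕ} (a : Fin k) (q : Fin n) (S : Fin r → Set (Fin n)) :
    Fin (k * n * (2 ^ n) ^ r) :=
  finProdFinEquiv (finProdFinEquiv (a, q), finFunctionFinEquiv (fun j => setIndex (S j)))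

/-- The automaton over `Fin k`-labeled `r`-relational digraphs described by a code, with the same
conventions on missing and oversized entries as above. -/
noncomputable def GenCode.toAut (k r : ℕ) (c : GenCode) :
    GenAut (Fin k) r (Fin (c.1 + 1)) where
  init := Fin.ofNat (c.1 + 1) c.2.1
  step a q S := Fin.ofNat (c.1 + 1) (c.2.2.1.getD (genIndex a q S) 0)
  accept := {q | (q : ℕ) ∈ c.2.2.2}

theorem setIndex_injective (n : ℕ) : Function.Injective (setIndex (n := n)) := by
  intro S T h
  have h' := congrFun (finFunctionFinEquiv.injective h)
  ext q
  have hq := h' q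
  by_cases h1 : q ∈ S <;> by_cases h2 : q ∈ T <;> simp_all

theorem distIndex_injective (n : ℕ) :
    Function.Injective (fun p : Fin n × Set (Fin n) => distIndex p.1 p.2) := by
  rintro ⟨q, S⟩ ⟨q', S'⟩ h
  have h' := finProdFinEquiv.injective h
  simp only [Prod.mk.injEq] at h'
  exact Prod.ext h'.1 (setIndex_injective n h'.2)

theorem genIndex_injective (k r n : ℕ) :
    Function.Injective (fun p : Fin k × Fin n × (Fin r → Set (Fin n)) =>
      genIndex p.1 p.2.1 p.2.2) := by
  rintro ⟨a, q, S⟩ ⟨a', q', S'⟩ h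
  have h' := finProdFinEquiv.injective h
  simp only [Prod.mk.injEq] at h'
  have h1 := finProdFinEquiv.injective h'.1
  simp only [Prod.mk.injEq] at h1
  have h2 := finFunctionFinEquiv.injective h'.2
  have h3 : S = S' := funext fun j => setIndex_injective n (congrFun h2 j)
  rw [h1.1, h1.2, h3]

theorem exists_table {ι : Type*} {m n : ℕ} (g : ι → Fin m) (hg : Function.Injective g)
    (f : ι → Fin (n + 1)) : ∃ l : List ℕ, ∀ i, Fin.ofNat (n + 1) (l.getD (g i) 0) = f i := by
  refine ⟨List.ofFn (fun j : Fin m => Function.extend g (fun i => (f i : ℕ)) 0 j), fun i => ?_⟩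
  have : (List.ofFn (fun j : Fin m => Function.extend g (fun i => (f i : ℕ)) 0 j)).getD (g i) 0
      = f i := by
    simp [List.getD, hg.extend_apply]
  rw [this]
  simp

theorem exists_list {n : ℕ} (F : Set (Fin n)) : ∃ l : List ℕ, {q : Fin n | (q : ℕ) ∈ l} = F := by
  classical
  refine ⟨(Finset.univ.filter (· ∈ F)).toList.map (fun q : Fin n => (q : ℕ)), ?_⟩
  ext q
  simp [Fin.val_inj]

/-- Every automaton in simplified form with state set `Fin (n + 1)` has a description. -/
theorem DistCode.exists_toAut {k n : ℕ} (A : DistAut (Fin k) (Fin (n + 1))) :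
    ∃ i t f : List ℕ, DistCode.toAut k (n, i, t, f) = A := by
  obtain ⟨i, hi⟩ := exists_table (fun a : Fin k => a) (fun _ _ h => h) A.init
  obtain ⟨t, ht⟩ := exists_table _ (distIndex_injective (n + 1)) (fun p => A.step p.1 p.2)
  obtain ⟨f, hf⟩ := exists_list A.accept
  refine ⟨i, t, f, ?_⟩
  cases A
  simp only [DistCode.toAut, DistAut.mk.injEq]
  exact ⟨funext hi, funext fun q => funext fun S => ht (q, S), hf⟩

/-- Every automaton in general form with state set `Fin (n + 1)` has a description. -/
theorem GenCode.exists_toAut {k r n : ℕ} (A : GenAut (Fin k) r (Fin (n + 1))) :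
    ∃ (i : ℕ) (t f : List ℕ), GenCode.toAut k r (n, i, t, f) = A := by
  obtain ⟨t, ht⟩ := exists_table _ (genIndex_injective k r (n + 1))
    (fun p => A.step p.1 p.2.1 p.2.2)
  obtain ⟨f, hf⟩ := exists_list A.accept
  refine ⟨A.init, t, f, ?_⟩
  cases A
  simp only [GenCode.toAut, GenAut.mk.injEq]
  exact ⟨by simp, funext fun a => funext fun q => funext fun S => ht (a, q, S), hf⟩

/-- No algorithm decides, for the inputs that satisfy `D`, whether they satisfy `P`
(its answer on other inputs being irrelevant). -/
def UndecidableOn {γ : Type*} [Primcodable γ] (D P : γ → Prop) : Prop :=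
  ¬ ∃ f : γ → Bool, Computable f ∧ ∀ c, D c → (f c = true ↔ P c)

end DA

/-! ### A fixed Turing machine with undecidable halting on a one-parameter family of inputs -/

namespace DA

open Turing StateTransition

/-! A monovisioned automaton cannot tell a digraph from a path. Suppose it accepts at time `t`, and
walk backwards from the accepting node. No node at distance `i` on this walk may be rejecting at a
time `s` with `s + i ≤ t`, since rejection would travel along the walk to the accepting node. So
before these times each node sees at most one state, and unrolling the walk into a path preserves
the run (`Monovisioned.exists_pointedPath`). Conversely, on dipaths only empty sets and singletons
are ever seen, so adding a rejecting sink for all other sets changes nothing there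
(`mem_language_iff_of_isDipath`).

For undecidability, let the nodes of a path, counted from the source, present the successive
configurations of a Turing machine, with space turned into time. Node `i` is idle, then shows the
scanned cell at time `2 * i + 1`, then the pairs of cells at distance 1, 2, … on both sides of the
head, one pair per time unit. Its successor computes the next configuration from this stream with
bounded memory and a delay of two (`display_next`). Hence a halting display occurs on some path
exactly if the machine halts (`exists_display_halting_iff`).

The machine `M` is fixed and only its input `a b c … c` varies. The source produces the input with a
counter whose size depends on `n`. So everything depending on `M` is a constant finite table, and
the reduction is primitive recursive in `n`. All nodes start in state `0` and labels are ignored,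
hence the result holds over every nonempty alphabet and carries over to the general form. -/

/-- A machine that is supported on a finite set of states halts on the same inputs as some machine
with finitely many states. -/
theorem TM0_exists_finite {Γ Λ : Type} [Inhabited Γ] [Inhabited Λ] (M : TM0.Machine Γ Λ)
    (S : Finset Λ) (hS : TM0.Supports M S) :
    ∃ (Λ' : Type) (_ : Inhabited Λ') (_ : Finite Λ') (M' : TM0.Machine Γ Λ'),
      ∀ l, (TM0.eval M' l).Dom ↔ (TM0.eval M l).Dom := by
  classical
  let _ : Inhabited S := ⟨⟨default, hS.1⟩⟩
  let g₁ : PointedMap Λ S :=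
    ⟨fun q => if h : q ∈ S then ⟨q, h⟩ else default, by
      have h : (default : Λ) ∈ S := hS.1
      rw [dif_pos h]; rfl⟩
  let f : PointedMap Γ Γ := ⟨id, rfl⟩
  refine ⟨S, inferInstance, inferInstance, M.map f f g₁ Subtype.val, fun l => ?_⟩
  have hresp := M.map_respects f f g₁ (Subtype.val : S → Λ) hS (fun _ => rfl)
    (fun q hq => by
      change ((if h : q ∈ S then (⟨q, h⟩ : S) else default : S) : Λ) = q
      rw [dif_pos (Finset.mem_coe.1 hq)])
  have h := tr_eval_dom hresp (a₁ := TM0.init l) (a₂ := TM0.init l)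
    ⟨hS.1, (TM0.map_init f g₁ l).trans (by
      congr 1; exact List.map_id l)⟩
  exact h

/-- Reduction of the halting problem for stack machines to that for Post-Turing machines. -/
theorem TM2_exists_TM0 {K Λ σ : Type} {Γ : K → Type} [DecidableEq K] [Inhabited Λ] [Inhabited σ]
    [Fintype σ] (M : Λ → TM2.Stmt Γ Λ σ) (S : Finset Λ) (hS : TM2.Supports M S) (k : K) :
    ∃ (Λ' : Type) (_ : Inhabited Λ') (_ : Finite Λ') (M' : TM0.Machine (TM2to1.Γ' K Γ) Λ'),
      ∀ L, (TM0.eval M' (TM2to1.trInit k L)).Dom ↔ (TM2.eval M k L).Dom := by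
  classical
  obtain ⟨Λ', i, f, M', h⟩ := TM0_exists_finite (TM1to0.tr (TM2to1.tr M)) _
    (TM1to0.tr_supports _ (TM2to1.tr_supports M hS))
  refine ⟨Λ', i, f, M', fun L => (h _).trans ?_⟩
  rw [TM1to0.tr_eval, TM2to1.tr_eval_dom]

theorem num_cast_two_pow (n : ℕ) : ((2 ^ (n + 1) : ℕ) : Num) = Num.bit0 ((2 ^ n : ℕ) : Num) := by
  rw [pow_succ, mul_two, Nat.cast_add, Num.bit0_of_bit0]

/-- Powers of two are used as inputs because their binary expansion is uniform up to one digit, so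
that a counter suffices to write it on the tape. -/
theorem trNat_two_pow (n : ℕ) : PartrecToTM2.trNat (2 ^ n) =
    List.replicate n PartrecToTM2.Γ'.bit0 ++ [PartrecToTM2.Γ'.bit1] := by
  suffices ∃ p : PosNum, ((2 ^ n : ℕ) : Num) = Num.pos p ∧ PartrecToTM2.trPosNum p =
      List.replicate n PartrecToTM2.Γ'.bit0 ++ [PartrecToTM2.Γ'.bit1] by
    obtain ⟨p, hp, h⟩ := this
    rw [PartrecToTM2.trNat, hp]; exact h
  induction n with
  | zero => exact ⟨PosNum.one, by simp; rfl, rfl⟩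
  | succ n ih =>
    obtain ⟨p, hp, h⟩ := ih
    exact ⟨PosNum.bit0 p, by rw [num_cast_two_pow, hp]; rfl, by
      rw [PartrecToTM2.trPosNum, h, List.replicate_succ, List.cons_append]⟩

/-- The function searches for `n` with `2 ^ (n + 1) = m`, diverging if there is none, and runs the
`n`-th program on input 0. The halting problem reduces to its domain via the numbering of programs.
-/
theorem exists_partrec_two_pow_undecidable :
    ∃ p : ℕ →. ℕ, Partrec p ∧ ¬ ComputablePred fun n : ℕ => (p (2 ^ (n + 1))).Dom := by
  let dec : ℕ → ℕ → Bool := fun m n => decide (2 ^ (n + 1) = m)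
  have hpow : Primrec₂ ((· ^ ·) : ℕ → ℕ → ℕ) := Primrec₂.unpaired'.1 Nat.Primrec.pow
  have hdec : Computable₂ dec := by
    refine Primrec₂.to_comp ?_
    refine (PrimrecRel.comp (Primrec.eq (α := ℕ)) (hpow.comp (Primrec.const 2)
      (Primrec.succ.comp Primrec.snd)) Primrec.fst).decide
  let p : ℕ →. ℕ := fun m => (Nat.rfind (fun n => Part.some (dec m n))).bind
    fun n => Nat.Partrec.Code.eval (Denumerable.ofNat Nat.Partrec.Code n) 0
  have hp : Partrec p := (Partrec.rfind hdec.partrec₂).bind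
    (Nat.Partrec.Code.eval_part.comp ((Computable.ofNat _).comp Computable.snd)
      (Computable.const 0))
  refine ⟨p, hp, fun h => ComputablePred.halting_problem 0
    (ComputablePred.computable_of_manyOneReducible ⟨Encodable.encode, Computable.encode, ?_⟩ h)⟩
  intro c
  have hr : Nat.rfind (fun n => Part.some (dec (2 ^ (Encodable.encode c + 1)) n))
      = Part.some (Encodable.encode c) := by
    refine Part.eq_some_iff.2 (Nat.mem_rfind.2 ⟨by simp [dec], fun {m} hm => ?_⟩)
    have : ¬ m = Encodable.encode c := hm.ne
    simp [dec, this]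
  simp only [p, hr, Part.bind_some, Denumerable.ofNat_encode]

/-- There is a Turing machine for which halting is undecidable on the inputs of the form
`a b c c … c`. -/
theorem exists_TM0_undecidable : ∃ (Γ Λ : Type) (_ : Inhabited Γ) (_ : Finite Γ) (_ : Inhabited Λ)
    (_ : Finite Λ) (M : TM0.Machine Γ Λ) (a b c : Γ),
    ¬ ComputablePred fun n : ℕ => (TM0.eval M (a :: b :: List.replicate (n + 1) c)).Dom := by
  obtain ⟨p, hp, hu⟩ := exists_partrec_two_pow_undecidable
  obtain ⟨C, hC⟩ := ToPartrec.Code.exists_code (Nat.Partrec'.part_iff₁.2 hp)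
  let _ : Inhabited PartrecToTM2.Λ' := ⟨PartrecToTM2.trNormal C PartrecToTM2.Cont'.halt⟩
  obtain ⟨Λ, i, f, M, h⟩ := TM2_exists_TM0 PartrecToTM2.tr _
    (PartrecToTM2.tr_supports C PartrecToTM2.Cont'.halt) PartrecToTM2.K'.main
  let s : PartrecToTM2.Γ' → TM2to1.Γ' PartrecToTM2.K' (fun _ => PartrecToTM2.Γ') := fun a =>
    (false, Function.update (fun _ => none) PartrecToTM2.K'.main (some a))
  let s' : TM2to1.Γ' PartrecToTM2.K' (fun _ => PartrecToTM2.Γ') :=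
    (true, Function.update (fun _ => none) PartrecToTM2.K'.main (some PartrecToTM2.Γ'.cons))
  refine ⟨_, Λ, inferInstance, ?_, i, f, M, s',
    s PartrecToTM2.Γ'.bit1, s PartrecToTM2.Γ'.bit0, fun hc => hu ?_⟩
  · have : Finite PartrecToTM2.K' := @Finite.of_fintype _
      ⟨{.main, .rev, .aux, .stack}, fun x => by cases x <;> simp⟩
    have : Finite (PartrecToTM2.K' → Option PartrecToTM2.Γ') := Pi.finite
    exact inferInstanceAs (Finite (Bool × (PartrecToTM2.K' → Option PartrecToTM2.Γ')))
  refine hc.of_eq fun n => ?_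
  -- The stack holds the digits, least significant first, and then the separator `cons`. `trInit`
  -- writes it from the bottom up, so the tape reads `cons`, the leading `bit1`, and then the
  -- `bit0`s; only the bottom cell carries the marker `true`.
  have hl : TM2to1.trInit (Γ := fun _ => PartrecToTM2.Γ') PartrecToTM2.K'.main
      (PartrecToTM2.trList [2 ^ (n + 1)]) =
      s' :: s PartrecToTM2.Γ'.bit1 :: List.replicate (n + 1) (s PartrecToTM2.Γ'.bit0) := by
    simp only [TM2to1.trInit, PartrecToTM2.trList, trNat_two_pow, List.append_assoc,
      List.reverse_append, List.reverse_cons, List.reverse_nil, List.nil_append,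
      List.reverse_replicate, List.cons_append]
    rw [← List.map_replicate]
    rfl
  rw [← hl, h]
  have hinit : (TM2.init PartrecToTM2.K'.main (PartrecToTM2.trList [2 ^ (n + 1)]) :
      PartrecToTM2.Cfg') = PartrecToTM2.init C [2 ^ (n + 1)] := by
    unfold TM2.init PartrecToTM2.init
    congr 1
    funext k
    cases k <;> rfl
  have := hC (2 ^ (n + 1) ::ᵥ List.Vector.nil)
  change (Part.map _ _).Dom ↔ _
  rw [hinit, PartrecToTM2.tr_eval]
  change (Part.map _ (ToPartrec.Code.eval C (2 ^ (n + 1) ::ᵥ List.Vector.nil).1)).Dom ↔ _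
  rw [this]
  rfl

end DA

/-! ### Paths, monovision and the behavior of automata on dipaths -/

namespace DA

/-- The directed path with nodes `m → m - 1 → ⋯ → 0`, labeled by `lab`. -/
def pathGraph {α : Type u} (m : ℕ) (lab : ℕ → α) : LDigraph α 1 where
  V := Fin (m + 1)
  finite := inferInstance
  nonempty := inferInstance
  E _ x y := (x : ℕ) = y + 1
  label x := lab x

/-- The directed path of length `m` pointed at its last node. -/
def pointedPath {α : Type u} (m : ℕ) (lab : ℕ → α) : PointedDigraph α 1 :=
  ⟨pathGraph m lab, (0 : Fin (m + 1))⟩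

theorem LDigraph.isWalk_singleton {α : Type u} {r : ℕ} {G : LDigraph α r} {x y a : G.V} :
    G.IsWalk x y [a] ↔ a = x ∧ a = y := by
  simp [LDigraph.IsWalk]

theorem LDigraph.not_isWalk_nil {α : Type u} {r : ℕ} {G : LDigraph α r} {x y : G.V} :
    ¬ G.IsWalk x y [] := fun h => Option.some_ne_none x h.1.symm

theorem LDigraph.isWalk_cons_cons {α : Type u} {r : ℕ} {G : LDigraph α r} {x y a b : G.V}
    {l : List G.V} :
    G.IsWalk x y (a :: b :: l) ↔ a = x ∧ (∃ k, G.E k x b) ∧ G.IsWalk b y (b :: l) := by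
  simp only [LDigraph.IsWalk, List.head?_cons, Option.some.injEq, List.getLast?_cons_cons,
    List.isChain_cons_cons, true_and]
  constructor
  · rintro ⟨rfl, h1, h2, h3⟩; exact ⟨rfl, h2, h1, h3⟩
  · rintro ⟨rfl, h1, h2, h3⟩; exact ⟨rfl, h2, h1, h3⟩

/-- By induction on the distance to the root: the only edge leaving `k + 1` goes to `k`, and none
leaves `0`, so every walk to the root is forced. -/
theorem pathGraph_existsUnique_walk {α : Type u} (m : ℕ) (lab : ℕ → α) :
    ∀ (k : ℕ) (hk : k < m + 1), ∃! l : List (Fin (m + 1)),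
      (pathGraph m lab).IsWalk (⟨k, hk⟩ : Fin (m + 1)) (0 : Fin (m + 1)) l := by
  intro k
  induction k with
  | zero =>
    intro hk
    refine ⟨[0], LDigraph.isWalk_singleton.2 ⟨rfl, rfl⟩, ?_⟩
    rintro (_ | ⟨a, _ | ⟨b, l⟩⟩) hl
    · exact absurd hl LDigraph.not_isWalk_nil
    · exact congrArg (· :: []) (LDigraph.isWalk_singleton.1 hl).1
    · obtain ⟨-, ⟨_, h⟩, -⟩ := LDigraph.isWalk_cons_cons.1 hl
      exact absurd (show (0 : ℕ) = (b : ℕ) + 1 from h) (by omega)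
  | succ k ih =>
    intro hk
    obtain ⟨l, hl, hu⟩ := ih (by omega)
    obtain _ | ⟨a, l⟩ := l
    · exact absurd hl LDigraph.not_isWalk_nil
    have ha : a = (⟨k, by omega⟩ : Fin (m + 1)) := Option.some.inj hl.1
    subst ha
    refine ⟨(⟨k + 1, hk⟩ : Fin (m + 1)) :: (⟨k, by omega⟩ : Fin (m + 1)) :: l,
      LDigraph.isWalk_cons_cons.2 ⟨rfl, ⟨0, rfl⟩, hl⟩, ?_⟩
    rintro (_ | ⟨a, _ | ⟨b, l'⟩⟩) hl'
    · exact absurd hl' LDigraph.not_isWalk_nil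
    · obtain ⟨h1, h2⟩ := LDigraph.isWalk_singleton.1 hl'
      have := congrArg Fin.val (h1.symm.trans h2)
      simp at this
    · obtain ⟨h1, ⟨_, h2⟩, h3⟩ := LDigraph.isWalk_cons_cons.1 hl'
      have hb : b = (⟨k, by omega⟩ : Fin (m + 1)) :=
        Fin.ext (Nat.succ.inj (show k + 1 = (b : ℕ) + 1 from h2)).symm
      subst hb
      exact congrArg₂ List.cons h1 (hu _ h3)

theorem pointedPath_isDipath {α : Type u} (m : ℕ) (lab : ℕ → α) :
    (pointedPath m lab).IsDipath := by
  refine ⟨⟨fun i j hij => absurd (Subsingleton.elim i j) hij, fun x => ?_⟩, ?_, ?_⟩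
  · exact pathGraph_existsUnique_walk m lab x.1 x.2
  · intro k x x' y h h'
    exact Fin.ext (Eq.trans (b := (Fin.val y) + 1) h (Eq.symm h'))
  · intro k l h
    omega

namespace DistAut

variable {α : Type u} {Q : Type v}

theorem run_pathGraph_succ (A : DistAut α Q) (m : ℕ) (lab : ℕ → α) (t i : ℕ) (h : i + 1 < m + 1) :
    A.run (pathGraph m lab) (t + 1) (⟨i, by omega⟩ : Fin (m + 1)) =
      A.step (A.run (pathGraph m lab) t (⟨i, by omega⟩ : Fin (m + 1)))
        {A.run (pathGraph m lab) t (⟨i + 1, h⟩ : Fin (m + 1))} := by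
  refine congrArg (A.step _) (Set.ext fun q => ?_)
  constructor
  · rintro ⟨x, hx, rfl⟩
    have : x = (⟨i + 1, h⟩ : Fin (m + 1)) := Fin.ext hx
    rw [this]; rfl
  · rintro rfl
    exact ⟨(⟨i + 1, h⟩ : Fin (m + 1)), rfl, rfl⟩

theorem run_pathGraph_last (A : DistAut α Q) (m : ℕ) (lab : ℕ → α) (t : ℕ) :
    A.run (pathGraph m lab) (t + 1) (⟨m, by omega⟩ : Fin (m + 1)) =
      A.step (A.run (pathGraph m lab) t (⟨m, by omega⟩ : Fin (m + 1))) ∅ := by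
  refine congrArg (A.step _) (Set.ext fun q => ?_)
  constructor
  · rintro ⟨x, hx, rfl⟩
    have h1 : (Fin.val x) = m + 1 := hx
    have h2 := Fin.is_lt (n := m + 1) x
    omega
  · rintro ⟨⟩

/-- A pointed digraph accepted by a monovisioned automaton can be replaced by a path obtained by
repeatedly moving to an incoming neighbor. -/
theorem Monovisioned.exists_pointedPath {A : DistAut α Q} (hA : A.Monovisioned)
    (h : A.language.Nonempty) : ∃ m lab, pointedPath m lab ∈ A.language := by
  classical
  obtain ⟨rej, hrej, hstep⟩ := hA
  obtain ⟨⟨G, v⟩, t, ht⟩ := h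
  change A.run G t v ∈ A.accept at ht
  let next : G.V → G.V := fun y => if h : ∃ x, G.E 0 x y then h.choose else y
  have hnext : ∀ y, (∃ x, G.E 0 x y) → G.E 0 (next y) y := fun y h => by
    simp only [next, dif_pos h]; exact h.choose_spec
  let w : ℕ → G.V := fun i => next^[i] v
  have hw : ∀ i, w (i + 1) = next (w i) := fun i => Function.iterate_succ_apply' next i v
  -- The backward walk stops at its first node without incoming neighbors if there is one, and
  -- otherwise after `t` edges. It may revisit nodes; the path unrolls it.
  obtain ⟨m, hm, hm'⟩ : ∃ m, (∀ i < m, ∃ x, G.E 0 x (w i)) ∧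
      (m = t ∨ ¬ ∃ x, G.E 0 x (w m)) := by
    by_cases h : ∃ i, ¬ ∃ x, G.E 0 x (w i)
    · exact ⟨Nat.find h, fun i hi => not_not.1 (Nat.find_min h hi), Or.inr (Nat.find_spec h)⟩
    · push Not at h
      exact ⟨t, fun i _ => h i, Or.inl rfl⟩
  have hedge : ∀ i < m, G.E 0 (w (i + 1)) (w i) := fun i hi => by
    rw [hw]; exact hnext _ (hm i hi)
  -- A sink state at `w i` at time `s` would reach `v` at time `s + i` and stay there until time
  -- `t`, contradicting acceptance.
  have hne : ∀ i, i ≤ m → ∀ s, s + i ≤ t → A.run G s (w i) ≠ rej := by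
    intro i
    induction i with
    | zero =>
      intro _ s hs hr
      have : ∀ s', s ≤ s' → A.run G s' v = rej := by
        intro s' hs'
        induction s', hs' using Nat.le_induction with
        | base => exact hr
        | succ s' _ ih => rw [run]; exact hstep _ _ (Or.inr (Or.inr ih))
      exact hrej (this t hs ▸ ht)
    | succ i ih =>
      intro hi s hs hr
      refine ih (by omega) (s + 1) (by omega) ?_
      rw [run]
      exact hstep _ _ (Or.inr (Or.inl ⟨w (i + 1), hedge i (by omega), hr⟩))
  let lab : ℕ → α := fun i => G.label (w i)
  -- The runs are compared only where they can influence the root by time `t`. If the walk was cut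
  -- at `m = t`, its last node is compared at time 0 only, so its missing neighbor does no harm.
  have key : ∀ s i, (hi : i < m + 1) → s + i ≤ t →
      A.run (pathGraph m lab) s (⟨i, hi⟩ : Fin (m + 1)) = A.run G s (w i) := by
    intro s
    induction s with
    | zero => intro i hi _; rfl
    | succ s ih =>
      intro i hi hs
      obtain hi' | rfl : i < m ∨ i = m := by omega
      · rw [run_pathGraph_succ A m lab s i (by omega), ih i hi (by omega),
          ih (i + 1) (by omega) (by omega), run]
        congr 1
        have h1 : ({q | ∃ x, G.E 0 x (w i) ∧ A.run G s x = q} : Set Q).encard ≤ 1 := by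
          by_contra hc
          exact hne i (by omega) (s + 1) hs
            (by rw [run]; exact hstep _ _ (Or.inl (not_le.1 hc)))
        ext q
        constructor
        · rintro rfl
          exact ⟨_, hedge i hi', rfl⟩
        · intro hq
          exact Set.encard_le_one_iff.1 h1 _ _ hq ⟨_, hedge i hi', rfl⟩
      · rw [run_pathGraph_last, ih i hi (by omega), run]
        congr 1
        ext q
        constructor
        · rintro ⟨⟩
        · rintro ⟨x, hx, -⟩
          rcases hm' with h | h
          · omega
          · exact absurd ⟨x, hx⟩ h
  refine ⟨m, lab, t, ?_⟩
  have h0 := key t 0 (by omega) (by omega)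
  change A.run (pathGraph m lab) t (⟨0, by omega⟩ : Fin (m + 1)) ∈ A.accept
  rw [h0]
  exact ht

/-- The state at time `t` of the `i`-th node of a path, counted from the source, if all nodes
start in state `q₀`. -/
def chainRun (A : DistAut α Q) (q₀ : Q) : ℕ → ℕ → Q
  | _, 0 => q₀
  | 0, t + 1 => A.step (chainRun A q₀ 0 t) ∅
  | i + 1, t + 1 => A.step (chainRun A q₀ (i + 1) t) {chainRun A q₀ i t}

theorem run_pathGraph_eq_chainRun (A : DistAut α Q) (q₀ : Q) (h : ∀ a, A.init a = q₀) (m : ℕ)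
    (lab : ℕ → α) : ∀ t i j, (hij : i + j = m) →
      A.run (pathGraph m lab) t (⟨i, by omega⟩ : Fin (m + 1)) = A.chainRun q₀ j t := by
  intro t
  induction t with
  | zero => intro i j _; rw [chainRun]; exact h _
  | succ t ih =>
    intro i j hij
    cases j with
    | zero =>
      obtain rfl : i = m := by omega
      rw [run_pathGraph_last, ih i 0 rfl, chainRun]
    | succ j =>
      rw [run_pathGraph_succ A m lab t i (by omega), ih i (j + 1) hij, ih (i + 1) j (by omega),
        chainRun]

/-- Information on a path flows only away from the source. With a common initial state, the `i`-th
node from the source therefore behaves alike on all paths, and one array of states describes all of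
them. -/
theorem Monovisioned.language_nonempty_iff_chainRun [Nonempty α] {A : DistAut α Q}
    (hA : A.Monovisioned) (q₀ : Q) (h : ∀ a, A.init a = q₀) :
    A.language.Nonempty ↔ ∃ i t, A.chainRun q₀ i t ∈ A.accept := by
  constructor
  · intro hn
    obtain ⟨m, lab, t, ht⟩ := hA.exists_pointedPath hn
    exact ⟨m, t, by rw [← A.run_pathGraph_eq_chainRun q₀ h m lab t 0 m (by omega)]; exact ht⟩
  · rintro ⟨i, t, hit⟩
    refine ⟨pointedPath i (fun _ => Classical.arbitrary α), t, ?_⟩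
    rw [← A.run_pathGraph_eq_chainRun q₀ h i (fun _ => Classical.arbitrary α) t 0 i (by omega)]
      at hit
    exact hit

theorem visible_eq_singleton {G : LDigraph α 1} {x y : G.V} (hx : G.E 0 x y)
    (hu : ∀ z, G.E 0 z y → z = x) (f : G.V → Q) : {q | ∃ z, G.E 0 z y ∧ f z = q} = {f x} := by
  ext q
  constructor
  · rintro ⟨z, hz, rfl⟩
    rw [hu z hz]; rfl
  · rintro rfl
    exact ⟨x, hx, rfl⟩

theorem visible_eq_empty {G : LDigraph α 1} {y : G.V} (h : ¬ ∃ x, G.E 0 x y) (f : G.V → Q) :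
    {q | ∃ z, G.E 0 z y ∧ f z = q} = ∅ :=
  Set.eq_empty_of_forall_notMem fun _ ⟨z, hz, _⟩ => h ⟨z, hz⟩

/-- Automata that behave in the same way on empty sets and singletons agree on dipaths. -/
theorem mem_language_iff_of_isDipath {Q' : Type*} {A : DistAut α Q} {A' : DistAut α Q'}
    (e : Q → Q') (hinit : ∀ a, A'.init a = e (A.init a))
    (h₀ : ∀ q, A'.step (e q) ∅ = e (A.step q ∅))
    (h₁ : ∀ q s, A'.step (e q) {e s} = e (A.step q {s}))
    (hacc : ∀ q, e q ∈ A'.accept ↔ q ∈ A.accept)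
    {P : PointedDigraph α 1} (hP : P.IsDipath) : P ∈ A'.language ↔ P ∈ A.language := by
  have key : ∀ t x, A'.run P.graph t x = e (A.run P.graph t x) := by
    intro t
    induction t with
    | zero => intro x; exact hinit _
    | succ t ih =>
      intro y
      rw [run, run, ih]
      by_cases h : ∃ x, P.graph.E 0 x y
      · obtain ⟨x, hx⟩ := h
        have hu : ∀ z, P.graph.E 0 z y → z = x := fun z hz => hP.2.1 0 z x y hz hx
        rw [visible_eq_singleton hx hu (A.run P.graph t),
          visible_eq_singleton hx hu (A'.run P.graph t), ih, h₁]
      · rw [visible_eq_empty h (A.run P.graph t), visible_eq_empty h (A'.run P.graph t), h₀]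
  exact exists_congr fun t => by rw [key, hacc]

open Classical in
/-- The automaton with an additional rejecting sink, entered whenever more than one state is
visible. -/
noncomputable def monovision (A : DistAut α Q) : DistAut α (Option Q) where
  init a := some (A.init a)
  step q S := if 1 < S.encard ∨ none ∈ S then none else q.map fun q => A.step q {s | some s ∈ S}
  accept := some '' A.accept

theorem monovision_monovisioned (A : DistAut α Q) : A.monovision.Monovisioned := by
  refine ⟨none, by simp [monovision], fun q S h => ?_⟩
  simp only [monovision]
  split_ifs with h'
  · rfl
  · rcases h with h | h | rfl
    · exact absurd (Or.inl h) h'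
    · exact absurd (Or.inr h) h'
    · rfl

theorem mem_language_monovision_iff (A : DistAut α Q) {P : PointedDigraph α 1}
    (hP : P.IsDipath) : P ∈ A.monovision.language ↔ P ∈ A.language := by
  refine mem_language_iff_of_isDipath some (fun _ => rfl) (fun q => ?_) (fun q s => ?_) ?_ hP
  · simp [monovision]
  · simp [monovision]
  · simp [monovision]

end DistAut

end DA

/-! ### Computable tables of monovisioned automata -/

namespace DA

theorem setIndex_empty (n : ℕ) : (setIndex (∅ : Set (Fin n)) : ℕ) = 0 := by
  simp [setIndex]

theorem setIndex_singleton {n : ℕ} (s : Fin n) : (setIndex {s} : ℕ) = 2 ^ (s : ℕ) := by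
  classical
  rw [setIndex, finFunctionFinEquiv_apply, Finset.sum_eq_single s]
  · simp
  · intro b _ hb
    simp [hb]
  · simp

/-- The entry for a state `q` and a set with index `m` in the table of a monovisioned automaton
with states `0, …, n` and rejecting sink `n + 1`, which moves from `q` to `g₀ q` if no state is
visible and to `g₁ q s` if only the state `s` is visible. -/
def monoEntry (n : ℕ) (g₀ : ℕ → ℕ) (g₁ : ℕ → ℕ → ℕ) (q m : ℕ) : ℕ :=
  if n < q then n + 1
  else if m = 0 then g₀ q
  else if (List.range (n + 1)).findIdx (fun s => decide (2 ^ s = m)) < n + 1 then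
    g₁ q ((List.range (n + 1)).findIdx (fun s => decide (2 ^ s = m)))
  else n + 1

/-- The table of the transition function with entries `monoEntry`. -/
def monoTable (n : ℕ) (g₀ : ℕ → ℕ) (g₁ : ℕ → ℕ → ℕ) : List ℕ :=
  (List.range ((n + 2) * 2 ^ (n + 2))).map fun i =>
    monoEntry n g₀ g₁ (i / 2 ^ (n + 2)) (i % 2 ^ (n + 2))

theorem distIndex_div {n : ℕ} (q : Fin n) (S : Set (Fin n)) :
    (distIndex q S : ℕ) / 2 ^ n = q := by
  rw [distIndex, finProdFinEquiv_apply_val, Nat.add_mul_div_left _ _ (by positivity),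
    Nat.div_eq_of_lt (setIndex S).isLt, zero_add]

theorem distIndex_mod {n : ℕ} (q : Fin n) (S : Set (Fin n)) :
    (distIndex q S : ℕ) % 2 ^ n = setIndex S := by
  rw [distIndex, finProdFinEquiv_apply_val, Nat.add_mul_mod_self_left,
    Nat.mod_eq_of_lt (setIndex S).isLt]

theorem distIndex_eq {n : ℕ} (q : Fin n) (S : Set (Fin n)) :
    (distIndex q S : ℕ) = q * 2 ^ n + setIndex S := by
  rw [distIndex, finProdFinEquiv_apply_val, add_comm, mul_comm]

theorem getD_map_range (N i : ℕ) (f : ℕ → ℕ) (h : i < N) :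
    ((List.range N).map f).getD i 0 = f i := by
  simp [List.getD, h]

theorem toAut_monoTable_step (k n : ℕ) (g₀ : ℕ → ℕ) (g₁ : ℕ → ℕ → ℕ) (i f : List ℕ)
    (q : Fin (n + 2)) (S : Set (Fin (n + 2))) :
    (DistCode.toAut k (n + 1, i, monoTable n g₀ g₁, f)).step q S =
      Fin.ofNat (n + 2) (monoEntry n g₀ g₁ q (setIndex S)) := by
  change Fin.ofNat (n + 2) ((monoTable n g₀ g₁).getD (distIndex q S) 0) = _
  rw [monoTable, getD_map_range _ _ _ (distIndex q S).isLt, distIndex_div, distIndex_mod]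

/-- Singletons have powers of two as indices, and `findIdx` acts as a bounded logarithm that returns
`n + 1` on failure. The exponent `n + 1`, belonging to the singleton of the sink, lies outside the
searched range. -/
theorem monoEntry_of_index_ne {n : ℕ} (g₀ : ℕ → ℕ) (g₁ : ℕ → ℕ → ℕ) (q : ℕ) {m : ℕ}
    (h₀ : m ≠ 0) (h : ∀ s ≤ n, 2 ^ s ≠ m) : monoEntry n g₀ g₁ q m = n + 1 := by
  have : ¬ (List.range (n + 1)).findIdx (fun s => decide (2 ^ s = m)) < n + 1 := by
    rw [not_lt]
    have := (List.findIdx_eq_length (xs := List.range (n + 1))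
      (p := fun s => decide (2 ^ s = m))).2 (fun s hs => by
        simpa using h s (Nat.lt_succ_iff.1 (List.mem_range.1 hs)))
    rw [this, List.length_range]
  rw [monoEntry, if_neg h₀, if_neg this, ite_self]

theorem monoEntry_zero {n : ℕ} (g₀ : ℕ → ℕ) (g₁ : ℕ → ℕ → ℕ) {q : ℕ} (hq : q ≤ n) :
    monoEntry n g₀ g₁ q 0 = g₀ q := by
  rw [monoEntry, if_neg (by omega), if_pos rfl]

theorem monoEntry_two_pow {n : ℕ} (g₀ : ℕ → ℕ) (g₁ : ℕ → ℕ → ℕ) {q s : ℕ} (hq : q ≤ n)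
    (hs : s ≤ n) : monoEntry n g₀ g₁ q (2 ^ s) = g₁ q s := by
  have : (List.range (n + 1)).findIdx (fun s' => decide (2 ^ s' = 2 ^ s)) = s := by
    rw [List.findIdx_eq (by simpa using Nat.lt_succ_iff.2 hs)]
    refine ⟨by simp, fun j hj => ?_⟩
    have : j ≠ s := hj.ne
    simp [this]
  rw [monoEntry, this, if_neg (by omega), if_neg (by positivity), if_pos (by omega)]

theorem toAut_monoTable_step_empty (k : ℕ) {n : ℕ} (g₀ : ℕ → ℕ) (g₁ : ℕ → ℕ → ℕ) (i f : List ℕ)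
    (q : Fin (n + 2)) (hq : (q : ℕ) ≤ n) :
    (DistCode.toAut k (n + 1, i, monoTable n g₀ g₁, f)).step q ∅ = Fin.ofNat (n + 2) (g₀ q) := by
  rw [toAut_monoTable_step, setIndex_empty, monoEntry_zero _ _ hq]

theorem toAut_monoTable_step_singleton (k : ℕ) {n : ℕ} (g₀ : ℕ → ℕ) (g₁ : ℕ → ℕ → ℕ)
    (i f : List ℕ) (q s : Fin (n + 2)) (hq : (q : ℕ) ≤ n) (hs : (s : ℕ) ≤ n) :
    (DistCode.toAut k (n + 1, i, monoTable n g₀ g₁, f)).step q {s} =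
      Fin.ofNat (n + 2) (g₁ q s) := by
  rw [toAut_monoTable_step, setIndex_singleton, monoEntry_two_pow _ _ hq hs]

/-- By injectivity of `setIndex`, a set with two elements or containing the sink has neither index 0
nor index `2 ^ s` with `s ≤ n`, so its table entry is the sink. The bound on `f` keeps the sink from
accepting. -/
theorem toAut_monoTable_monovisioned (k n : ℕ) (g₀ : ℕ → ℕ) (g₁ : ℕ → ℕ → ℕ) (i f : List ℕ)
    (hf : ∀ x ∈ f, x ≤ n) : (DistCode.toAut k (n + 1, i, monoTable n g₀ g₁, f)).Monovisioned := by
  refine ⟨Fin.last (n + 1), fun h => ?_, fun q S h => ?_⟩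
  · have : n + 1 ≤ n := hf _ h
    omega
  rw [toAut_monoTable_step]
  suffices monoEntry n g₀ g₁ q (setIndex S) = n + 1 by
    rw [this]; exact Fin.ext (Nat.mod_eq_of_lt (Nat.lt_succ_self _))
  by_cases hq : q = Fin.last (n + 1)
  · rw [hq, monoEntry, if_pos (by simp)]
  have hS : 1 < S.encard ∨ Fin.last (n + 1) ∈ S := by tauto
  refine monoEntry_of_index_ne _ _ _ (fun h0 => ?_) (fun s hs h0 => ?_)
  · have : S = ∅ := setIndex_injective _ (Fin.ext (h0.trans (setIndex_empty _).symm))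
    subst this
    simp at hS
  · let s' : Fin (n + 2) := ⟨s, by omega⟩
    have : S = {s'} :=
      setIndex_injective _ (Fin.ext (h0.symm.trans (setIndex_singleton s').symm))
    rw [this] at hS
    rcases hS with h | h
    · simp at h
    · have := congrArg Fin.val (Set.mem_singleton_iff.1 h)
      simp [s'] at this
      omega

theorem primrec_pow : Primrec₂ ((· ^ ·) : ℕ → ℕ → ℕ) := Primrec₂.unpaired'.1 Nat.Primrec.pow

theorem primrec_monoTable {γ : Type*} [Primcodable γ] {n : γ → ℕ} {g₀ : γ → ℕ → ℕ}
    {g₁ : γ → ℕ → ℕ → ℕ} (hn : Primrec n) (h₀ : Primrec₂ g₀)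
    (h₁ : Primrec₂ fun (a : γ) (p : ℕ × ℕ) => g₁ a p.1 p.2) :
    Primrec fun a => monoTable (n a) (g₀ a) (g₁ a) := by
  have hsz : Primrec fun a => 2 ^ (n a + 2) :=
    primrec_pow.comp (Primrec.const 2) (Primrec.nat_add.comp hn (Primrec.const 2))
  have hN : Primrec fun p : γ × ℕ × ℕ => n p.1 := hn.comp Primrec.fst
  have hq : Primrec fun p : γ × ℕ × ℕ => p.2.1 := Primrec.fst.comp Primrec.snd
  have hm : Primrec fun p : γ × ℕ × ℕ => p.2.2 := Primrec.snd.comp Primrec.snd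
  have hs : Primrec fun p : γ × ℕ × ℕ =>
      (List.range (n p.1 + 1)).findIdx (fun s => decide (2 ^ s = p.2.2)) := by
    refine Primrec.list_findIdx (Primrec.list_range.comp (Primrec.succ.comp hN)) ?_
    exact (PrimrecRel.comp (Primrec.eq (α := ℕ)) (primrec_pow.comp (Primrec.const 2) Primrec.snd)
      (hm.comp Primrec.fst)).decide
  have hentry : Primrec fun p : γ × ℕ × ℕ => monoEntry (n p.1) (g₀ p.1) (g₁ p.1) p.2.1 p.2.2 := by
    have hN1 := Primrec.succ.comp hN
    refine Primrec.ite (Primrec.nat_lt.comp hN hq) hN1 ?_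
    refine Primrec.ite (Primrec.eq.comp hm (Primrec.const 0)) (h₀.comp Primrec.fst hq) ?_
    exact Primrec.ite (Primrec.nat_lt.comp hs hN1) (h₁.comp Primrec.fst (hq.pair hs)) hN1
  refine Primrec.list_map (Primrec.list_range.comp (Primrec.nat_mul.comp
    (Primrec.nat_add.comp hn (Primrec.const 2)) hsz)) ?_
  exact hentry.comp (Primrec.fst.pair
    ((Primrec.nat_div.comp Primrec.snd (hsz.comp Primrec.fst)).pair
      (Primrec.nat_mod.comp Primrec.snd (hsz.comp Primrec.fst))))

/-- A description of a monovisioned automaton that agrees on dipaths with the given one. -/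
def DistCode.monovision (k : ℕ) (c : DistCode) : DistCode :=
  (c.1 + 1, (List.range k).map (fun a => c.2.1.getD a 0 % (c.1 + 1)),
    monoTable c.1 (fun q => c.2.2.1.getD (q * 2 ^ (c.1 + 1)) 0 % (c.1 + 1))
      (fun q s => c.2.2.1.getD (q * 2 ^ (c.1 + 1) + 2 ^ s) 0 % (c.1 + 1)),
    c.2.2.2.filter (fun x => decide (x < c.1 + 1)))

theorem primrec_list_filter {γ : Type*} [Primcodable γ] {l : γ → List ℕ} {p : γ → ℕ → Bool}
    (hl : Primrec l) (hp : Primrec₂ p) : Primrec fun a => (l a).filter (p a) := by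
  refine (Primrec.listFilterMap hl (g := fun a x => bif p a x then some x else none) ?_).of_eq ?_
  · exact Primrec.cond hp (Primrec.option_some.comp Primrec.snd) (Primrec.const none)
  · intro a
    rw [← List.filterMap_eq_filter]
    congr 1
    funext x
    cases h : p a x <;> simp [Option.guard, h]

theorem DistCode.primrec_monovision (k : ℕ) : Primrec (DistCode.monovision k) := by
  have hn : Primrec fun c : DistCode => c.1 := Primrec.fst
  have hn1 : Primrec fun c : DistCode => c.1 + 1 := Primrec.succ.comp hn
  have hi : Primrec fun c : DistCode => c.2.1 := Primrec.fst.comp Primrec.snd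
  have ht : Primrec fun c : DistCode => c.2.2.1 :=
    Primrec.fst.comp (Primrec.snd.comp Primrec.snd)
  have hf : Primrec fun c : DistCode => c.2.2.2 :=
    Primrec.snd.comp (Primrec.snd.comp Primrec.snd)
  have hpow : Primrec fun c : DistCode => 2 ^ (c.1 + 1) := primrec_pow.comp (Primrec.const 2) hn1
  refine (Primrec.succ.comp hn).pair (Primrec.pair ?_ (Primrec.pair ?_ ?_))
  · refine Primrec.list_map (Primrec.const _) ?_
    exact Primrec.nat_mod.comp ((Primrec.list_getD 0).comp (hi.comp Primrec.fst) Primrec.snd)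
      (hn1.comp Primrec.fst)
  · refine primrec_monoTable hn ?_ ?_
    · exact Primrec.nat_mod.comp ((Primrec.list_getD 0).comp (ht.comp Primrec.fst)
        (Primrec.nat_mul.comp Primrec.snd (hpow.comp Primrec.fst))) (hn1.comp Primrec.fst)
    · exact Primrec.nat_mod.comp ((Primrec.list_getD 0).comp (ht.comp Primrec.fst)
        (Primrec.nat_add.comp
          (Primrec.nat_mul.comp (Primrec.fst.comp Primrec.snd) (hpow.comp Primrec.fst))
          (primrec_pow.comp (Primrec.const 2) (Primrec.snd.comp Primrec.snd))))
        (hn1.comp Primrec.fst)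
  · exact primrec_list_filter hf (Primrec.nat_lt.comp Primrec.snd (hn1.comp Primrec.fst)).decide

/-- An entry `n + 1` in the list of accepting states is meaningless for the old automaton but would
make the new sink accepting; the filter removes it. -/
theorem DistCode.monovision_monovisioned (k : ℕ) (c : DistCode) :
    (DistCode.toAut k (c.monovision k)).Monovisioned :=
  toAut_monoTable_monovisioned _ _ _ _ _ _ fun x hx => by
    have := List.of_mem_filter hx
    simp only [decide_eq_true_eq] at this
    omega

/-- Entries are read modulo the number of states, which grows by one with the sink. Reducing by the
old modulus first preserves their meaning. -/
theorem ofNat_mod_eq_castSucc (n x : ℕ) :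
    Fin.ofNat (n + 2) (x % (n + 1)) = (Fin.ofNat (n + 1) x).castSucc := by
  refine Fin.ext ?_
  simp only [Fin.ofNat, Fin.val_castSucc]
  exact Nat.mod_eq_of_lt ((Nat.mod_lt _ (Nat.succ_pos n)).trans (Nat.lt_succ_self _))

theorem DistCode.mem_language_monovision_iff (k : ℕ) (c : DistCode)
    {P : PointedDigraph (Fin k) 1} (hP : P.IsDipath) :
    P ∈ (DistCode.toAut k (c.monovision k)).language ↔ P ∈ (DistCode.toAut k c).language := by
  obtain ⟨n, i, t, f⟩ := c
  refine DistAut.mem_language_iff_of_isDipath (Fin.castSucc : Fin (n + 1) → Fin (n + 2))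
    (fun a => ?_) (fun q => ?_) (fun q s => ?_) (fun q => ?_) hP
  · change Fin.ofNat (n + 2) (((List.range k).map _).getD (a : ℕ) 0) = _
    rw [getD_map_range _ _ _ a.isLt]
    exact ofNat_mod_eq_castSucc _ _
  · refine (toAut_monoTable_step_empty k _ _ _ _ q.castSucc (Nat.lt_succ_iff.1 q.isLt)).trans ?_
    refine (ofNat_mod_eq_castSucc _ _).trans (congrArg (fun x => (Fin.ofNat _ x).castSucc) ?_)
    change t.getD _ 0 = t.getD (distIndex q ∅) 0
    rw [distIndex_eq, setIndex_empty]; rfl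
  · refine (toAut_monoTable_step_singleton k _ _ _ _ q.castSucc s.castSucc
      (Nat.lt_succ_iff.1 q.isLt) (Nat.lt_succ_iff.1 s.isLt)).trans ?_
    refine (ofNat_mod_eq_castSucc _ _).trans (congrArg (fun x => (Fin.ofNat _ x).castSucc) ?_)
    change t.getD _ 0 = t.getD (distIndex q {s}) 0
    rw [distIndex_eq, setIndex_singleton]; rfl
  · change (q : ℕ) ∈ f.filter (fun x => decide (x < n + 1)) ↔ (q : ℕ) ∈ f
    simp [List.mem_filter, Nat.lt_succ_iff.1 q.isLt]

/-! ### Transfer to the general form -/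

/-- If an automaton in simplified form starts all nodes in the same state, then it is empty iff
the automaton in general form that only looks at one edge relation is empty. -/
theorem GenAut.language_nonempty_iff {α : Type u} {Q : Type v} {r : ℕ} (A : DistAut α Q)
    (A' : GenAut α (r + 1) Q) (hinit : ∀ a, A.init a = A'.init)
    (hstep : ∀ a q S, A'.step a q S = A.step q (S 0)) (hacc : A'.accept = A.accept) :
    A'.language.Nonempty ↔ A.language.Nonempty := by
  -- Neither the labels nor the relations other than the 0-th need to correspond, since neither
  -- automaton looks at them.
  have key : ∀ (G : LDigraph α (r + 1)) (G' : LDigraph α 1) (hV : G.V = G'.V),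
      (∀ x y, G.E 0 x y ↔ G'.E 0 (cast hV x) (cast hV y)) →
      ∀ t x, A'.run G t x = A.run G' t (cast hV x) := by
    rintro ⟨V, _, _, E, l⟩ ⟨V', _, _, E', l'⟩ hV hE t
    dsimp only at hV
    subst hV
    induction t with
    | zero => exact fun x => (hinit _).symm
    | succ t ih =>
      intro y
      rw [GenAut.run, hstep, DistAut.run, ih]
      refine congrArg (A.step _) (Set.ext fun q => exists_congr fun x => ?_)
      rw [ih x]
      exact and_congr (hE x y) Iff.rfl
  constructor
  · rintro ⟨⟨G, v⟩, t, ht⟩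
    let G' : LDigraph α 1 := ⟨G.V, G.finite, G.nonempty, fun _ => G.E 0, G.label⟩
    refine ⟨⟨G', v⟩, t, ?_⟩
    rw [← hacc]
    exact (key G G' rfl (fun _ _ => Iff.rfl) t v) ▸ ht
  · rintro ⟨⟨G, v⟩, t, ht⟩
    let G' : LDigraph α (r + 1) := ⟨G.V, G.finite, G.nonempty, fun _ => G.E 0, G.label⟩
    refine ⟨⟨G', v⟩, t, ?_⟩
    rw [hacc]
    exact (key G' G rfl (fun _ _ => Iff.rfl) t v).symm ▸ ht

/-- A description of the automaton in general form that behaves like the automaton in simplified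
form with the given description, except that all nodes start in state `0`. -/
def DistCode.toGenCode (k r : ℕ) (c : DistCode) : GenCode :=
  (c.1, 0, (List.range (k * (c.1 + 1) * (2 ^ (c.1 + 1)) ^ r)).map (fun i =>
    c.2.2.1.getD ((i / (2 ^ (c.1 + 1)) ^ r % (c.1 + 1)) * 2 ^ (c.1 + 1) + i % 2 ^ (c.1 + 1)) 0),
    c.2.2.2)

theorem DistCode.primrec_toGenCode (k r : ℕ) : Primrec (DistCode.toGenCode k r) := by
  have hn : Primrec fun c : DistCode => c.1 := Primrec.fst
  have hn1 : Primrec fun c : DistCode => c.1 + 1 := Primrec.succ.comp hn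
  have ht : Primrec fun c : DistCode => c.2.2.1 :=
    Primrec.fst.comp (Primrec.snd.comp Primrec.snd)
  have hf : Primrec fun c : DistCode => c.2.2.2 :=
    Primrec.snd.comp (Primrec.snd.comp Primrec.snd)
  have hpow : Primrec fun c : DistCode => 2 ^ (c.1 + 1) := primrec_pow.comp (Primrec.const 2) hn1
  have hpow' : Primrec fun c : DistCode => (2 ^ (c.1 + 1)) ^ r :=
    primrec_pow.comp hpow (Primrec.const r)
  refine hn.pair ((Primrec.const 0).pair (Primrec.pair ?_ hf))
  refine Primrec.list_map (Primrec.list_range.comp (Primrec.nat_mul.comp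
    (Primrec.nat_mul.comp (Primrec.const k) hn1) hpow')) ?_
  refine (Primrec.list_getD 0).comp (ht.comp Primrec.fst) (Primrec.nat_add.comp
    (Primrec.nat_mul.comp (Primrec.nat_mod.comp
      (Primrec.nat_div.comp Primrec.snd (hpow'.comp Primrec.fst)) (hn1.comp Primrec.fst))
      (hpow.comp Primrec.fst)) (Primrec.nat_mod.comp Primrec.snd (hpow.comp Primrec.fst)))

theorem genIndex_div {k r n : ℕ} (a : Fin k) (q : Fin n) (S : Fin r → Set (Fin n)) :
    (genIndex a q S : ℕ) / (2 ^ n) ^ r % n = q := by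
  rw [genIndex, finProdFinEquiv_apply_val, Nat.add_mul_div_left _ _ (by positivity),
    Nat.div_eq_of_lt (finFunctionFinEquiv _).isLt, zero_add, finProdFinEquiv_apply_val,
    Nat.add_mul_mod_self_left, Nat.mod_eq_of_lt q.isLt]

/-- The set seen along relation 0 is the least significant digit of the index in base `2 ^ n`. -/
theorem genIndex_mod {k r n : ℕ} (a : Fin k) (q : Fin n) (S : Fin (r + 1) → Set (Fin n)) :
    (genIndex a q S : ℕ) % 2 ^ n = setIndex (S 0) := by
  have h : (2 ^ n) ^ (r + 1) = 2 ^ n * (2 ^ n) ^ r := pow_succ' _ _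
  have h' : ∑ j : Fin r, (setIndex (S j.succ) : ℕ) * (2 ^ n) ^ ((j.succ : Fin (r + 1)) : ℕ) =
      2 ^ n * ∑ j : Fin r, (setIndex (S j.succ) : ℕ) * (2 ^ n) ^ (j : ℕ) := by
    rw [Finset.mul_sum]
    refine Finset.sum_congr rfl fun j _ => ?_
    rw [Fin.val_succ, pow_succ']
    ring
  simp only [genIndex, finProdFinEquiv_apply_val, finFunctionFinEquiv_apply]
  rw [h, mul_assoc, Nat.add_mul_mod_self_left, Fin.sum_univ_succ, h', Nat.add_mul_mod_self_left,
    Fin.val_zero, pow_zero, mul_one, Nat.mod_eq_of_lt (setIndex (S 0)).isLt]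

/-- The empty initialization table is read as `0` for every label, which matches the single initial
state `0` of the general form. -/
theorem DistCode.language_toGenCode_nonempty_iff (k r n : ℕ) (t f : List ℕ) :
    (GenCode.toAut k (r + 1) (DistCode.toGenCode k (r + 1) (n, [], t, f))).language.Nonempty ↔
      (DistCode.toAut k (n, [], t, f)).language.Nonempty := by
  refine GenAut.language_nonempty_iff (Q := Fin (n + 1)) _ _ (fun a => rfl) (fun a q S => ?_) rfl
  change Fin.ofNat (n + 1) (((List.range (k * (n + 1) * (2 ^ (n + 1)) ^ (r + 1))).map _).getD
    (genIndex a q S) 0) = Fin.ofNat (n + 1) (t.getD (distIndex q (S 0)) 0)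
  rw [getD_map_range _ _ _ (genIndex a q S).isLt, genIndex_div, genIndex_mod, distIndex_eq]

end DA

/-! ### Simulation of a Turing machine along a path -/

namespace DA

open Turing

/-- The states of the nodes of a path whose successive nodes present the successive configurations
of a Turing machine cell by cell, starting with the scanned cell and continuing with the pairs of
cells at distance `1, 2, …` to its left and right. In the states `head` and `body` a node stores
the direction of the current move and the last two pairs of cells that it has seen. The states
`first` and `counter` are used by the source of the path only. -/
inductive SimState (Γ Λ : Type) : Type
  | idle : SimState Γ Λ
  | seen : Λ → Γ → SimState Γ Λ
  | head : Λ → Γ → Option Dir → Γ × Γ → Γ × Γ → SimState Γ Λ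
  | body : Γ × Γ → Option Dir → Γ × Γ → Γ × Γ → SimState Γ Λ
  | first : SimState Γ Λ
  | counter : SimState Γ Λ

namespace SimState

variable {Γ Λ : Type}

instance [Finite Γ] [Finite Λ] : Finite (SimState Γ Λ) := by
  have : Finite Dir := Finite.of_injective (fun d => decide (d = Dir.left)) (by
    intro a b; cases a <;> cases b <;> simp)
  let f : Fin 3 ⊕ (Λ × Γ) ⊕ (Λ × Γ × Option Dir × (Γ × Γ) × (Γ × Γ)) ⊕
      ((Γ × Γ) × Option Dir × (Γ × Γ) × (Γ × Γ)) → SimState Γ Λ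
    | .inl 0 => idle
    | .inl 1 => first
    | .inl 2 => counter
    | .inr (.inl (q, a)) => seen q a
    | .inr (.inr (.inl (q, a, d, x, y))) => head q a d x y
    | .inr (.inr (.inr (w, d, x, y))) => body w d x y
  refine Finite.of_surjective f ?_
  rintro (_ | ⟨q, a⟩ | ⟨q, a, d, x, y⟩ | ⟨w, d, x, y⟩ | _ | _)
  · exact ⟨.inl 0, rfl⟩
  · exact ⟨.inr (.inl (q, a)), rfl⟩
  · exact ⟨.inr (.inr (.inl (q, a, d, x, y))), rfl⟩
  · exact ⟨.inr (.inr (.inr (w, d, x, y))), rfl⟩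
  · exact ⟨.inl 1, rfl⟩
  · exact ⟨.inl 2, rfl⟩

variable [Inhabited Γ]

/-- The part of a configuration that is presented by a state, for the input letters `b`
and `c` of the source. -/
def display (b c : Γ) : SimState Γ Λ → Option ((Λ × Γ) ⊕ (Γ × Γ))
  | idle => none
  | seen _ _ => none
  | head q a _ _ _ => some (.inl (q, a))
  | body w _ _ _ => some (.inr w)
  | first => some (.inr (default, b))
  | counter => some (.inr (default, c))

/-- The pair of cells at some distance from the head after a move, computed from the pairs of
cells at neighboring distances before the move. -/
def shift : Option Dir → Γ × Γ → Γ × Γ → Γ × Γ → Γ × Γ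
  | none, _, y, _ => y
  | some Dir.left, x, _, z => (z.1, x.2)
  | some Dir.right, x, _, z => (x.1, z.2)

variable [Inhabited Λ]

/-- The transition function of the inner nodes of the path. -/
def recv (M : TM0.Machine Γ Λ) : SimState Γ Λ → Option ((Λ × Γ) ⊕ (Γ × Γ)) → SimState Γ Λ
  | idle, some (.inl (q, a)) => seen q a
  | seen q a, some (.inr z) =>
    match M q a with
    | none => idle
    | some (q', .move Dir.left) => head q' z.1 (some Dir.left) (a, a) z
    | some (q', .move Dir.right) => head q' z.2 (some Dir.right) (a, a) z
    | some (q', .write b) => head q' b none (a, a) z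
  | head _ _ d x y, some (.inr z) => body (shift d x y z) d y z
  | body _ d x y, some (.inr z) => body (shift d x y z) d y z
  | _, _ => idle

/-- The transition function of the source, apart from counting. -/
def emit (a : Γ) : SimState Γ Λ → SimState Γ Λ
  | idle => head default a none default default
  | head _ _ _ _ _ => first
  | body w d x y => body w d x y
  | counter => body default none default default
  | _ => idle

end SimState

/-- The pairs of cells of a tape by their distance to the head. -/
def tapeCell {Γ : Type} [Inhabited Γ] (T : Tape Γ) : ℕ → Γ × Γ
  | 0 => (T.head, T.head)
  | j + 1 => (T.left.nth j, T.right.nth j)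

/-- The sequence of parts of a configuration that is presented by a node. -/
def cfgCell {Γ Λ : Type} [Inhabited Γ] [Inhabited Λ] (C : TM0.Cfg Γ Λ) :
    ℕ → (Λ × Γ) ⊕ (Γ × Γ)
  | 0 => .inl (C.q, C.Tape.head)
  | j + 1 => .inr (tapeCell C.Tape (j + 1))

variable {Γ Λ : Type} [Inhabited Γ] [Inhabited Λ]

/-- A move shifts the two half-tapes by one cell in opposite directions, so a new pair depends only
on the old pairs at the same and the two adjacent distances. Counting the scanned cell as the pair
at distance 0 makes this rule uniform. The new scanned symbol may come from distance 1, hence the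
waiting state `seen`. -/
theorem recv_seen_of_step (M : TM0.Machine Γ Λ) (C C' : TM0.Cfg Γ Λ)
    (h : TM0.step M C = some C') :
    ∃ d, SimState.recv M (.seen C.q C.Tape.head) (some (.inr (tapeCell C.Tape 1))) =
        .head C'.q C'.Tape.head d (tapeCell C.Tape 0) (tapeCell C.Tape 1) ∧
      ∀ j, tapeCell C'.Tape (j + 1) = SimState.shift d (tapeCell C.Tape j)
        (tapeCell C.Tape (j + 1)) (tapeCell C.Tape (j + 2)) := by
  obtain ⟨q, T⟩ := C
  simp only [TM0.step, Option.map_eq_some_iff] at h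
  obtain ⟨⟨q', s⟩, hM, rfl⟩ := h
  rcases s with (_ | _) | b
  · refine ⟨some Dir.left, ?_, ?_⟩
    · simp only [SimState.recv, hM, tapeCell, Tape.move, ListBlank.nth_zero]
    · rintro (_ | j)
      · simp [tapeCell, SimState.shift, Tape.move, ListBlank.nth_succ]
      · simp [tapeCell, SimState.shift, Tape.move, ListBlank.nth_succ]
  · refine ⟨some Dir.right, ?_, ?_⟩
    · simp only [SimState.recv, hM, tapeCell, Tape.move, ListBlank.nth_zero]
    · rintro (_ | j)
      · simp [tapeCell, SimState.shift, Tape.move, ListBlank.nth_succ]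
      · simp [tapeCell, SimState.shift, Tape.move, ListBlank.nth_succ]
  · refine ⟨none, ?_, ?_⟩
    · simp only [SimState.recv, hM, tapeCell, Tape.write]
    · intro j
      simp [tapeCell, SimState.shift, Tape.write]

/-- If a node presents a configuration that is not halting, then the next node presents the
successor configuration with a delay of two. -/
theorem display_next (M : TM0.Machine Γ Λ) (b c : Γ) (C C' : TM0.Cfg Γ Λ)
    (h : TM0.step M C = some C') (σ τ : ℕ → SimState Γ Λ) (k : ℕ)
    (hσ : ∀ t < k, (σ t).display b c = none)
    (hσ' : ∀ m, (σ (k + m)).display b c = some (cfgCell C m))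
    (hτ : τ 0 = .idle) (hτ' : ∀ t, τ (t + 1) = (τ t).recv M ((σ t).display b c)) :
    (∀ t < k + 2, (τ t).display b c = none) ∧
      ∀ m, (τ (k + 2 + m)).display b c = some (cfgCell C' m) := by
  obtain ⟨d, hd, hd'⟩ := recv_seen_of_step M C C' h
  have h1 : ∀ t ≤ k, τ t = .idle := by
    intro t
    induction t with
    | zero => exact fun _ => hτ
    | succ t ih =>
      intro ht
      rw [hτ', ih (by omega), hσ t (by omega)]; rfl
  have h2 : τ (k + 1) = .seen C.q C.Tape.head := by
    rw [hτ', h1 k le_rfl, show (σ k).display b c = _ from hσ' 0]; rfl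
  have h3 : τ (k + 2) = .head C'.q C'.Tape.head d (tapeCell C.Tape 0) (tapeCell C.Tape 1) := by
    rw [hτ', h2, hσ' 1]; exact hd
  have h4 : ∀ m, τ (k + 2 + (m + 1)) = .body (tapeCell C'.Tape (m + 1)) d
      (tapeCell C.Tape (m + 1)) (tapeCell C.Tape (m + 2)) := by
    intro m
    induction m with
    | zero =>
      rw [← add_assoc, hτ', h3, hσ' 2, hd']; rfl
    | succ m ih =>
      rw [← add_assoc, hτ', ih, show k + 2 + (m + 1) = k + (m + 3) by ring, hσ' (m + 3),
        hd' (m + 1)]; rfl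
  refine ⟨fun t ht => ?_, ?_⟩
  · obtain ht' | rfl : t ≤ k ∨ t = k + 1 := by omega
    · rw [h1 t ht']; rfl
    · rw [h2]; rfl
  · rintro (_ | m)
    · rw [add_zero, h3]; rfl
    · rw [h4]; rfl

/-- The sequence of configurations of a Turing machine, constant after halting. -/
def cfgSeq (M : TM0.Machine Γ Λ) (C : TM0.Cfg Γ Λ) : ℕ → TM0.Cfg Γ Λ
  | 0 => C
  | i + 1 => (TM0.step M (cfgSeq M C i)).getD (cfgSeq M C i)

theorem eval_dom_iff_cfgSeq (M : TM0.Machine Γ Λ) (l : List Γ) :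
    (TM0.eval M l).Dom ↔ ∃ h, TM0.step M (cfgSeq M (TM0.init l) h) = none := by
  change (StateTransition.eval _ _).Dom ↔ _
  rw [Part.dom_iff_mem]
  constructor
  · rintro ⟨C, hC⟩
    obtain ⟨hr, hn⟩ := StateTransition.mem_eval.1 hC
    suffices ∃ i, cfgSeq M (TM0.init l) i = C by
      obtain ⟨i, rfl⟩ := this
      exact ⟨i, hn⟩
    clear hC hn
    induction hr with
    | refl => exact ⟨0, rfl⟩
    | tail _ hs ih =>
      obtain ⟨i, rfl⟩ := ih
      exact ⟨i + 1, by rw [cfgSeq, Option.mem_def.1 hs]; rfl⟩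
  · rintro ⟨h, hh⟩
    refine ⟨_, StateTransition.mem_eval.2 ⟨?_, hh⟩⟩
    clear hh
    induction h with
    | zero => exact Relation.ReflTransGen.refl
    | succ i ih =>
      rw [cfgSeq]
      cases hs : TM0.step M (cfgSeq M (TM0.init l) i) with
      | none => exact ih
      | some C => exact ih.tail hs

/-- If the source of a path presents the initial configuration, then some node presents a halting
configuration iff the machine halts. -/
theorem exists_display_halting_iff (M : TM0.Machine Γ Λ) (b c : Γ) (l : List Γ)
    (τ : ℕ → ℕ → SimState Γ Λ) (hinit : ∀ i, τ i 0 = .idle)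
    (hsrc : ∀ m, (τ 0 (m + 1)).display b c = some (cfgCell (TM0.init l) m))
    (hstep : ∀ i t, τ (i + 1) (t + 1) = (τ (i + 1) t).recv M ((τ i t).display b c)) :
    (∃ i t q a, (τ i t).display b c = some (.inl (q, a)) ∧ M q a = none) ↔
      (TM0.eval M l).Dom := by
  -- The source starts its display at time 1 and each further node adds a delay of two.
  have key : ∀ i, (∀ j < i, TM0.step M (cfgSeq M (TM0.init l) j) ≠ none) →
      (∀ t < 2 * i + 1, (τ i t).display b c = none) ∧
        ∀ m, (τ i (2 * i + 1 + m)).display b c = some (cfgCell (cfgSeq M (TM0.init l) i) m) := by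
    intro i
    induction i with
    | zero =>
      intro _
      refine ⟨fun t ht => ?_, fun m => ?_⟩
      · obtain rfl : t = 0 := by omega
        rw [hinit]; rfl
      · rw [mul_zero, zero_add, add_comm]; exact hsrc m
    | succ i ih =>
      intro hj
      obtain ⟨h1, h2⟩ := ih fun j hji => hj j (by omega)
      obtain ⟨C', hC'⟩ := Option.ne_none_iff_exists'.1 (hj i (by omega))
      have h3 : cfgSeq M (TM0.init l) (i + 1) = C' := by rw [cfgSeq, hC']; rfl
      rw [h3]
      exact display_next M b c _ C' hC' (τ i) (τ (i + 1)) (2 * i + 1) h1 h2 (hinit _) (hstep i)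
  have hnone : ∀ C : TM0.Cfg Γ Λ, TM0.step M C = none ↔ M C.q C.Tape.head = none := by
    rintro ⟨q, T⟩
    simp [TM0.step]
  rw [eval_dom_iff_cfgSeq]
  constructor
  · rintro ⟨i, t, q, a, h, hM⟩
    -- If the machine never halts, `key` describes all nodes at all times. Thus the behavior beyond
    -- a node that shows a halting configuration need not be analyzed.
    by_contra! hc
    obtain ⟨h1, h2⟩ := key i fun j _ => hc j
    by_cases ht : t < 2 * i + 1
    · rw [h1 t ht] at h
      simp at h
    · obtain ⟨m, rfl⟩ := Nat.exists_eq_add_of_le (not_lt.1 ht)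
      rw [h2 m] at h
      cases m with
      | zero =>
        simp only [cfgCell, Option.some.injEq, Sum.inl.injEq, Prod.mk.injEq] at h
        refine hc i ((hnone _).2 ?_)
        rw [h.1, h.2, hM]
      | succ m => simp [cfgCell] at h
  · intro hh
    classical
    refine ⟨Nat.find hh, _, _, _, (key (Nat.find hh) fun j hj => Nat.find_min hh hj).2 0,
      (hnone _).1 (Nat.find_spec hh)⟩

end DA

/-! ### The reduction and the undecidability results -/

namespace DA

open Turing

/-- An eventually constant function is a lookup in a fixed finite list. This makes the data derived
from `M` primitive recursive, although the numbering of states is obtained by choice. -/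
theorem primrec_of_min (N : ℕ) (f : ℕ → ℕ) (hf : ∀ q, f q = f (min q N)) : Primrec f := by
  refine (((Primrec.list_getD 0).comp (Primrec.const ((List.range (N + 1)).map f))
    (Primrec.nat_min.comp Primrec.id (Primrec.const N)))).of_eq fun q => ?_
  rw [hf q]
  exact getD_map_range _ _ _ (by simp only [id]; omega)

theorem primrec₂_of_min (N : ℕ) (f : ℕ → ℕ → ℕ) (hf : ∀ q s, f q s = f (min q N) (min s N)) :
    Primrec₂ f := by
  refine ((Primrec.list_getD 0).comp ((Primrec.list_getD []).comp
    (Primrec.const ((List.range (N + 1)).map fun q => (List.range (N + 1)).map (f q)))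
    (Primrec.nat_min.comp Primrec.fst (Primrec.const N)))
    (Primrec.nat_min.comp Primrec.snd (Primrec.const N))).of_eq fun p => ?_
  have h : ((List.range (N + 1)).map fun q => (List.range (N + 1)).map (f q)).getD (min p.1 N) [] =
      (List.range (N + 1)).map (f (min p.1 N)) := by
    have : min p.1 N < N + 1 := by omega
    simp [List.getD, this]
  rw [h, getD_map_range _ _ _ (by omega)]
  exact (hf p.1 p.2).symm

/-- The code 0 goes to `z` because 0 is the default initial state. Decoding all large numbers as `d`
lets the counter values share one role. -/
theorem exists_numbering {S : Type} [Finite S] (z d : S) : ∃ (N : ℕ) (enc : S → ℕ) (dec : ℕ → S),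
    (∀ s, enc s < N) ∧ (∀ s, dec (enc s) = s) ∧ enc z = 0 ∧ ∀ q, N ≤ q → dec q = d := by
  classical
  let e := Finite.equivFin S
  have h0 : 0 < Nat.card S := (Nat.zero_le _).trans_lt (e z).isLt
  let e' := e.trans (Equiv.swap (e z) ⟨0, h0⟩)
  refine ⟨Nat.card S, fun s => e' s, fun q => if h : q < Nat.card S then e'.symm ⟨q, h⟩ else d,
    fun s => (e' s).isLt, fun s => ?_, ?_, fun q hq => ?_⟩
  · simp
  · simp [e']
  · simp [not_lt.2 hq]

/-- The values of the source of a path that counts down from `N + n` to `N`. -/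
theorem source_values {N n x₁ x₂ x₃ : ℕ} {g : ℕ → ℕ} {f : ℕ → ℕ} (h₀ : f 1 = x₁)
    (h₁ : g x₁ = x₂) (h₂ : g x₂ = N + n) (hcount : ∀ q, N < q → g q = q - 1) (hN : g N = x₃)
    (h₃ : g x₃ = x₃) (hf : ∀ t, f (t + 1) = g (f t)) :
    f 2 = x₂ ∧ (∀ j ≤ n, f (3 + j) = N + n - j) ∧ ∀ j, f (4 + n + j) = x₃ := by
  have h2 : f 2 = x₂ := by rw [hf, h₀, h₁]
  have h3 : ∀ j ≤ n, f (3 + j) = N + n - j := by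
    intro j
    induction j with
    | zero => intro _; rw [add_zero, hf, h2, h₂]; rfl
    | succ j ih =>
      intro hj
      rw [← add_assoc, hf, ih (by omega), hcount _ (by omega)]
      omega
  refine ⟨h2, h3, fun j => ?_⟩
  induction j with
  | zero => rw [add_zero, show 4 + n = 3 + n + 1 by ring, hf, h3 n le_rfl,
      Nat.add_sub_cancel, hN]
  | succ j ih => rw [← add_assoc, hf, ih, h₃]

/-- The cells of an initial configuration. -/
theorem cfgCell_init {Γ Λ : Type} [Inhabited Γ] [Inhabited Λ] (a b c : Γ) (n : ℕ) :
    let C : TM0.Cfg Γ Λ := TM0.init (a :: b :: List.replicate (n + 1) c)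
    cfgCell C 0 = .inl (default, a) ∧ cfgCell C 1 = .inr (default, b) ∧
      (∀ j ≤ n, cfgCell C (2 + j) = .inr (default, c)) ∧
      ∀ j, cfgCell C (3 + n + j) = .inr (default, default) := by
  intro C
  have hC : ∀ j, cfgCell C (j + 1) =
      .inr (default, (b :: List.replicate (n + 1) c).getI j) := by
    intro j
    simp only [C, cfgCell, tapeCell, TM0.init, Tape.mk₁, Tape.mk₂, Tape.mk'_left, Tape.mk'_right,
      ListBlank.tail_mk, ListBlank.nth_mk, List.tail_cons, List.getI_nil]
  refine ⟨rfl, hC 0, fun j hj => ?_, fun j => ?_⟩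
  · rw [show 2 + j = (j + 1) + 1 by ring, hC, List.getI_cons_succ, List.getI_eq_getElem _
      (by simpa using Nat.lt_succ_iff.2 hj), List.getElem_replicate]
  · rw [show 3 + n + j = (n + j + 1 + 1) + 1 by ring, hC, List.getI_cons_succ,
      List.getI_eq_default _ (by simp)]

/-- Reduction of the halting problem for inputs of the form `a b c … c` to the emptiness problem
for monovisioned automata that start in state `0`. -/
theorem exists_primrec_reduction {Γ Λ : Type} [Inhabited Γ] [Finite Γ] [Inhabited Λ] [Finite Λ]
    (M : TM0.Machine Γ Λ) (a b c : Γ) :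
    ∃ m : ℕ → ℕ, ∃ t f : ℕ → List ℕ, Primrec (fun n => ((m n, [], t n, f n) : DistCode)) ∧
      ∀ n k, 1 ≤ k → (DistCode.toAut k (m n, [], t n, f n)).Monovisioned ∧
        ((DistCode.toAut k (m n, [], t n, f n)).language.Nonempty ↔
          (TM0.eval M (a :: b :: List.replicate (n + 1) c)).Dom) := by
  classical
  obtain ⟨N, enc, dec, henc, hdec, henc0, hcounter⟩ :=
    exists_numbering (SimState.idle : SimState Γ Λ) SimState.counter
  have hinj : Function.Injective enc := Function.LeftInverse.injective hdec
  have hmin : ∀ q, dec (min q N) = dec q := fun q => by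
    rcases le_total q N with h | h
    · rw [min_eq_left h]
    · rw [min_eq_right h, hcounter q h, hcounter N le_rfl]
  have hdec0 : dec 0 = .idle := by rw [← henc0, hdec]
  -- From `first` the source jumps to `N + n` and counts down. The values `N + n, …, N` all decode
  -- to `counter`, so `c` is shown `n + 1` times; from `N` the source moves on to blanks forever.
  let g₀ : ℕ → ℕ → ℕ := fun n q =>
    if N < q then q - 1 else if q = enc .first then N + n else enc ((dec q).emit a)
  let g₁ : ℕ → ℕ → ℕ := fun q s => enc ((dec q).recv M ((dec s).display b c))
  let halting : SimState Γ Λ → Prop := fun s =>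
    ∃ q a, s.display b c = some (.inl (q, a)) ∧ M q a = none
  let acc : List ℕ := (List.range N).filter fun q => decide (halting (dec q))
  have hacc : ∀ q, q ∈ acc ↔ halting (dec q) := by
    intro q
    simp only [acc, List.mem_filter, List.mem_range, decide_eq_true_eq, and_iff_right_iff_imp]
    rintro ⟨q', a', h, -⟩
    by_contra hq
    rw [hcounter q (not_lt.1 hq)] at h
    simp [SimState.display] at h
  have hg₀ : Primrec₂ g₀ := by
    have hemit : Primrec fun q => enc ((dec q).emit a) :=
      primrec_of_min N _ fun q => by rw [hmin]
    refine Primrec.ite (Primrec.nat_lt.comp (Primrec.const N) Primrec.snd)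
      (Primrec.pred.comp Primrec.snd) ?_
    exact Primrec.ite (Primrec.eq.comp Primrec.snd (Primrec.const _))
      (Primrec.nat_add.comp (Primrec.const N) Primrec.fst) (hemit.comp Primrec.snd)
  have hg₁ : Primrec₂ g₁ := primrec₂_of_min N _ fun q s => by simp only [g₁, hmin]
  -- There are `N` simulation states, `n + 1` counter values and the sink, that is, `N + n + 2`
  -- states; a code stores one less.
  refine ⟨fun n => N + n + 1, fun n => monoTable (N + n) (g₀ n) g₁, fun _ => acc, ?_, ?_⟩
  · have hN : Primrec fun n => N + n := Primrec.nat_add.comp (Primrec.const N) Primrec.id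
    exact (Primrec.succ.comp hN).pair ((Primrec.const []).pair
      ((primrec_monoTable (g₁ := fun _ => g₁) hN hg₀ (hg₁.comp (Primrec.fst.comp Primrec.snd)
        (Primrec.snd.comp Primrec.snd))).pair (Primrec.const acc)))
  intro n k hk
  have hmono := toAut_monoTable_monovisioned k (N + n) (g₀ n) g₁ [] acc fun x hx => by
    have := List.mem_range.1 (List.mem_of_mem_filter hx)
    omega
  refine ⟨hmono, ?_⟩
  have : Nonempty (Fin k) := ⟨⟨0, hk⟩⟩
  rw [hmono.language_nonempty_iff_chainRun (0 : Fin (N + n + 2)) fun _ => rfl]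
  set A := DistCode.toAut k (N + n + 1, [], monoTable (N + n) (g₀ n) g₁, acc) with hA
  let V : ℕ → ℕ → ℕ := fun i t => (A.chainRun (0 : Fin (N + n + 2)) i t : Fin (N + n + 2))
  have hg₀le : ∀ q ≤ N + n, g₀ n q ≤ N + n := by
    intro q hq
    simp only [g₀]
    split_ifs
    · omega
    · exact le_rfl
    · exact (henc _).le.trans (Nat.le_add_right _ _)
  have hg₁le : ∀ q s, g₁ q s ≤ N + n := fun q s => (henc _).le.trans (Nat.le_add_right _ _)
  have hval : ∀ x ≤ N + n, (Fin.ofNat (N + n + 2) x : ℕ) = x := fun x hx =>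
    Nat.mod_eq_of_lt (by omega)
  have hV0 : ∀ i, V i 0 = 0 := fun i => by cases i <;> rfl
  have hVsrc' : ∀ t, V 0 t ≤ N + n → V 0 (t + 1) = g₀ n (V 0 t) := fun t h =>
    (congrArg Fin.val (toAut_monoTable_step_empty k (g₀ n) g₁ [] acc
      (A.chainRun (0 : Fin (N + n + 2)) 0 t) h)).trans (hval _ (hg₀le _ h))
  have hVstep' : ∀ i t, V (i + 1) t ≤ N + n → V i t ≤ N + n →
      V (i + 1) (t + 1) = g₁ (V (i + 1) t) (V i t) := fun i t h h' =>
    (congrArg Fin.val (toAut_monoTable_step_singleton k (g₀ n) g₁ [] acc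
      (A.chainRun (0 : Fin (N + n + 2)) (i + 1) t) (A.chainRun (0 : Fin (N + n + 2)) i t)
      h h')).trans (hval _ (hg₁le _ _))
  -- The sink is never reached on a path, so `g₀` and `g₁` govern the whole run.
  have hVle : ∀ t i, V i t ≤ N + n := by
    intro t
    induction t with
    | zero => intro i; rw [hV0]; exact Nat.zero_le _
    | succ t ih =>
      rintro (_ | i)
      · rw [hVsrc' t (ih 0)]; exact hg₀le _ (ih 0)
      · rw [hVstep' i t (ih _) (ih _)]; exact hg₁le _ _
  have hVsrc : ∀ t, V 0 (t + 1) = g₀ n (V 0 t) := fun t => hVsrc' t (hVle _ _)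
  have hVstep : ∀ i t, V (i + 1) (t + 1) = g₁ (V (i + 1) t) (V i t) := fun i t =>
    hVstep' i t (hVle _ _) (hVle _ _)
  have hemit : ∀ s, s ≠ .first → g₀ n (enc s) = enc (s.emit a) := fun s hs => by
    have h1 := henc s
    have h2 : enc s ≠ enc .first := fun h => hs (hinj h)
    simp only [g₀, if_neg h1.not_gt, if_neg h2, hdec]
  have hfirst : g₀ n (enc .first) = N + n := by
    simp only [g₀, if_neg (henc _).not_gt, if_true]
  have s1 : V 0 1 = enc (.head default a none default default) := by
    rw [hVsrc, hV0, ← henc0, hemit _ (by simp)]; rfl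
  obtain ⟨s2, s3, s4⟩ := source_values (f := V 0) (g := g₀ n) (N := N) (n := n)
    (x₁ := enc (.head default a none default default)) (x₂ := enc .first)
    (x₃ := enc (.body default none default default))
    s1 (hemit _ (by simp)) hfirst
    (fun q hq => by simp only [g₀, if_pos hq])
    (by
      have h : ¬ N = enc .first := (henc _).ne'
      simp only [g₀, lt_irrefl, if_false, if_neg h, hcounter N le_rfl]; rfl)
    (hemit _ (by simp)) hVsrc
  obtain ⟨c0, c1, c2, c3⟩ := cfgCell_init (Λ := Λ) a b c n
  rw [← exists_display_halting_iff M b c _ (fun i t => dec (V i t))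
    (fun i => by rw [hV0, hdec0]) (fun m => ?_) (fun i t => by rw [hVstep, hdec])]
  · exact exists_congr fun i => exists_congr fun t => hacc (V i t)
  · obtain rfl | rfl | ⟨j, hj, rfl⟩ | ⟨j, rfl⟩ :
        m = 0 ∨ m = 1 ∨ (∃ j, j ≤ n ∧ m = 2 + j) ∨ ∃ j, m = 3 + n + j := by
      by_cases h : m < 3 + n
      · by_cases h' : m < 2
        · omega
        · exact Or.inr (Or.inr (Or.inl ⟨m - 2, by omega, by omega⟩))
      · exact Or.inr (Or.inr (Or.inr ⟨m - (3 + n), by omega⟩))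
    · rw [c0, s1, hdec]; rfl
    · rw [c1, s2, hdec]; rfl
    · rw [c2 j hj, show 2 + j + 1 = 3 + j by ring, s3 j hj, hcounter _ (by omega)]; rfl
    · rw [c3 j, show 3 + n + j + 1 = 4 + n + j by ring, s4 j, hdec]; rfl

/-- There is an undecidable problem that reduces to the emptiness problem for monovisioned automata
that start all nodes in state `0`. -/
theorem exists_hard_family : ∃ m : ℕ → ℕ, ∃ t f : ℕ → List ℕ, ∃ H : ℕ → Prop,
    ¬ ComputablePred H ∧ Primrec (fun n => ((m n, [], t n, f n) : DistCode)) ∧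
      ∀ n k, 1 ≤ k → (DistCode.toAut k (m n, [], t n, f n)).Monovisioned ∧
        ((DistCode.toAut k (m n, [], t n, f n)).language.Nonempty ↔ H n) := by
  obtain ⟨Γ, Λ, _, _, _, _, M, a, b, c, hu⟩ := exists_TM0_undecidable
  obtain ⟨m, t, f, h1, h2⟩ := exists_primrec_reduction M a b c
  exact ⟨m, t, f, _, hu, h1, h2⟩

theorem undecidableOn_monovisioned (k : ℕ) (hk : 1 ≤ k) :
    UndecidableOn (fun c : DistCode => (DistCode.toAut k c).Monovisioned)
      (fun c => (DistCode.toAut k c).language.Nonempty) := by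
  rintro ⟨d, hd, hd'⟩
  obtain ⟨m, t, f, H, hH, hp, h⟩ := exists_hard_family
  refine hH (ComputablePred.computable_iff.2 ⟨_, hd.comp hp.to_comp, funext fun n => propext ?_⟩)
  rw [hd' _ (h n k hk).1]
  exact (h n k hk).2.symm

theorem not_computablePred_nonempty (k : ℕ) (hk : 1 ≤ k) :
    ¬ ComputablePred (fun c : DistCode => (DistCode.toAut k c).language.Nonempty) := by
  intro hc
  obtain ⟨d, hd, hd'⟩ := ComputablePred.computable_iff.1 hc
  exact undecidableOn_monovisioned k hk ⟨d, hd, fun c _ => (iff_of_eq (congrFun hd' c)).symm⟩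

theorem not_computablePred_gen_nonempty (k r : ℕ) (hk : 1 ≤ k) (hr : 1 ≤ r) :
    ¬ ComputablePred (fun c : GenCode => (GenCode.toAut k r c).language.Nonempty) := by
  obtain ⟨r, rfl⟩ := Nat.exists_eq_add_of_le' hr
  intro hc
  obtain ⟨m, t, f, H, hH, hp, h⟩ := exists_hard_family
  refine hH (ComputablePred.computable_of_manyOneReducible
    ⟨_, ((DistCode.primrec_toGenCode k (r + 1)).comp hp).to_comp, fun n => ?_⟩ hc)
  exact (h n k hk).2.symm.trans (DistCode.language_toGenCode_nonempty_iff k r _ _ _).symm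

end DA

theorem mainTheorem3 :
    -- a monovisioned automaton has nonempty language iff it accepts some pointed dipath
    (∀ (α : Type u) [Finite α] (Q : Type v) [Finite Q] [Nonempty Q] (A : DA.DistAut α Q),
      A.Monovisioned →
        (A.language.Nonempty ↔ ∃ P : DA.PointedDigraph α 1, P.IsDipath ∧ P ∈ A.language)) ∧
    -- every automaton agrees on dipaths with some monovisioned automaton
    (∀ (α : Type u) [Finite α] (Q : Type v) [Finite Q] [Nonempty Q] (A : DA.DistAut α Q),
      ∃ (Q' : Type v) (_ : Finite Q') (_ : Nonempty Q') (A' : DA.DistAut α Q'),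
        A'.Monovisioned ∧
          ∀ P : DA.PointedDigraph α 1, P.IsDipath → (P ∈ A'.language ↔ P ∈ A.language)) ∧
    -- and such an automaton can be computed
    (∀ k : ℕ, ∃ f : DA.DistCode → DA.DistCode, Computable f ∧ ∀ c : DA.DistCode,
      (DA.DistCode.toAut k (f c)).Monovisioned ∧
        ∀ P : DA.PointedDigraph (Fin k) 1, P.IsDipath →
          (P ∈ (DA.DistCode.toAut k (f c)).language ↔ P ∈ (DA.DistCode.toAut k c).language)) ∧
    -- emptiness is undecidable for monovisioned automata, over every nonempty finite alphabet
    (∀ k : ℕ, 1 ≤ k →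
      DA.UndecidableOn (fun c : DA.DistCode => (DA.DistCode.toAut k c).Monovisioned)
        (fun c => (DA.DistCode.toAut k c).language.Nonempty)) ∧
    -- emptiness is undecidable for arbitrary automata in simplified form
    (∀ k : ℕ, 1 ≤ k →
      ¬ ComputablePred (fun c : DA.DistCode => (DA.DistCode.toAut k c).language.Nonempty)) ∧
    -- and in general form, for every number of edge relations
    (∀ k r : ℕ, 1 ≤ k → 1 ≤ r →
      ¬ ComputablePred (fun c : DA.GenCode => (DA.GenCode.toAut k r c).language.Nonempty)) := by
  refine ⟨fun α _ Q _ _ A hA => ⟨fun h => ?_, ?_⟩, fun α _ Q _ _ A => ?_, fun k => ?_,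
    DA.undecidableOn_monovisioned, DA.not_computablePred_nonempty,
    DA.not_computablePred_gen_nonempty⟩
  · obtain ⟨m, lab, h⟩ := hA.exists_pointedPath h
    exact ⟨_, DA.pointedPath_isDipath m lab, h⟩
  · rintro ⟨P, -, h⟩
    exact ⟨P, h⟩
  · exact ⟨Option Q, inferInstance, inferInstance, A.monovision, A.monovision_monovisioned,
      fun _ hP => A.mem_language_monovision_iff hP⟩
  · exact ⟨_, (DA.DistCode.primrec_monovision k).to_comp, fun c =>
      ⟨DA.DistCode.monovision_monovisioned k c, fun _ hP =>
        DA.DistCode.mem_language_monovision_iff k c hP⟩⟩
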